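/- **Setting.** A \emph{computation states structure} $(L,\mathcal P)$ is a set $L$ of states with real-valued features $P(\cdot):L\to\mathbb R$ ($P\in\mathcal P$, where $\mathcal P$ may be uncountable) such that each state $v$ is determined by its type $\operatorname{tp}(v)=(P(v))_{P\in\mathcal P}\in\mathbb R^{\mathcal P}$. Identify $L$ with its image in $\mathbb R^{\mathcal P}$ (product topology), and let $\mathcal L=\overline L$. A \emph{sizer} is a family $r_\bullet=(r_P)_{P\in\mathcal P}$ of positive reals. Put $L[r_\bullet]=L\cap\prod_P[-r_P,r_P]$ (a shard), $\mathcal L[r_\bullet]=\overline{L[r_\bullet]}$ (a type shard, compact), and $\mathcal L_{\mathrm{sh}}=\bigcup_{r_\bullet}\mathcal L[r_\bullet]$. A \emph{compositional computation structure} (CCS) $(L,\mathcal P,\Gamma)$ has in addition a set $\Gamma\subseteq L^L$ of computations that is closed under composition and contains the identity. A map $\tilde\gamma:\mathcal L_{\mathrm{sh}}\to\mathcal L_{\mathrm{sh}}$ is a \emph{$K$-extension} of $\gamma:L\to L$ if it extends $\gamma$ and for every sizer $r_\bullet$ there is a sizer $s_\bullet$ such that $\tilde\gamma$ restricts to a continuous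 map $\mathcal L[r_\bullet]\to\mathcal L[s_\bullet]$; it is unique if it exists. The \emph{Extendibility Axiom} says that every $\gamma\in\Gamma$ has a $K$-extension. A set $R$ of sizers is \emph{exhaustive} if $L=\bigcup_{r_\bullet\in R}L[r_\bullet]$, and $\Delta\subseteq\Gamma$ is \emph{$R$-confined} if $\gamma(L[r_\bullet])\subseteq L[r_\bullet]$ for all $\gamma\in\Delta$ and $r_\bullet\in R$. The \emph{deep computations} of $\Delta$ are the members of the closure $\overline\Delta$ of $\Delta$ in the product space $\mathcal L^L$. For a compact Hausdorff space $X$, a set $A\subseteq\mathbb R^X$ is \emph{universally Talagrand stable} if for every Radon probability measure $\mu$ on $X$, every $\mu$-measurable $E\subseteq X$ with $\mu(E)>0$ and all reals $a<b$ there is $k\ge1$ such that $$(\mu^{2k})^*\Bigl(\bigcup_{h\in A}\{x\in E^{2k}: h(x_{2i})\le a,\ h(x_{2i+1})\ge b\ \text{for all } i<k\}\Bigr)<\mu(E)^{2k},$$ where $\mu^{2k}$ is the product measure and $^*$ denotes outer measure. A map $f:L\to\mathcal L$ is \emph{Monte Carlo computable on the shards of $R$} if it has an extension $\tilde f:\mathcal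 L_{\mathrm{sh}}\to\mathcal L_{\mathrm{sh}}$ such that for every $r_\bullet\in R$ there is a sizer $s_\bullet$ with $\tilde f(\mathcal L[r_\bullet])\subseteq\mathcal L[s_\bullet]$ and such that for every $P\in\mathcal P$ the function $\pi_P\circ\tilde f|_{\mathcal L[r_\bullet]}$ (where $\pi_P$ is the $P$-th coordinate) is $\mu$-measurable for every Radon probability measure $\mu$ on $\mathcal L[r_\bullet]$. It is \emph{universally Monte Carlo computable} if this holds with $R$ the set of all sizers. **Statement.** Let $(L,\mathcal P,\Gamma)$ be a CCS satisfying the Extendibility Axiom, $R$ an exhaustive set of sizers, and $\Delta\subseteq\Gamma$ an $R$-confined set. Suppose that for every $P\in\mathcal P$ and every sizer $r_\bullet$ the set $\{\pi_P\circ\tilde\gamma|_{\mathcal L[r_\bullet]}:\gamma\in\Delta\}$ of functions on $\mathcal L[r_\bullet]$, where $\tilde\gamma$ is the $K$-extension of $\gamma$, is universally Talagrand stable. Then every deep computation $f\in\overline\Delta$ is Monte Carlo computable on the shards of $R$. If, moreover, for every sizer $r_\bullet$ there is a sizer $s_\bullet$ with $\gamma(L[r_\bullet])\subseteq L[s_\bullet]$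 for all $\gamma\in\Delta$ (for instance, if every shard is contained in a shard $L[r_\bullet]$ with $r_\bullet\in R$), then every $f\in\overline\Delta$ is universally Monte Carlo computable. -/

import Mathlib

open MeasureTheory Set

/-! ### Measurability and Talagrand stability

Radon measures live on the Borel sigma-algebra, which on subspaces of uncountable powers of `ℝ` is
larger than the product sigma-algebra; hence `borel X` is used explicitly below. A Radon
probability measure on a compact Hausdorff space is a Borel probability measure that is inner
regular with respect to compact sets. -/

/-- The set `D_k(A, E, a, b)` of all `x ∈ E^{2k}` such that some `f ∈ A` satisfies
`f (x_{2i}) ≤ a` and `f (x_{2i+1}) ≥ b` for all `i < k`. -/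
def talagrandSet {X : Type*} (A : Set (X → ℝ)) (E : Set X) (k : ℕ) (a b : ℝ) :
    Set (Fin (2 * k) → X) :=
  {x | (∀ j, x j ∈ E) ∧ ∃ f ∈ A, ∀ i : Fin k,
    f (x ⟨2 * i.val, by omega⟩) ≤ a ∧ b ≤ f (x ⟨2 * i.val + 1, by omega⟩)}

/-- Talagrand `μ`-stability. The value of `Measure.pi` on an arbitrary set is the outer measure
of that set. -/
def IsTalagrandStable {X : Type*} [MeasurableSpace X] (μ : Measure X) (A : Set (X → ℝ)) : Prop :=
  ∀ E : Set X, NullMeasurableSet E μ → 0 < μ E → ∀ a b : ℝ, a < b →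
    ∃ k : ℕ, 1 ≤ k ∧
      Measure.pi (fun _ : Fin (2 * k) => μ) (talagrandSet A E k a b) < μ E ^ (2 * k)

/-- Talagrand `μ`-stability for every Radon probability measure `μ` on `X`. -/
def IsUniversallyTalagrandStable {X : Type*} [TopologicalSpace X] (A : Set (X → ℝ)) : Prop :=
  letI : MeasurableSpace X := borel X
  ∀ μ : Measure X, IsProbabilityMeasure μ → μ.InnerRegular → IsTalagrandStable μ A

/-- `g` is `μ`-measurable (measurable for the completion of `μ`) for every Radon probability
measure `μ` on `X`. -/
def IsUniversallyMeasurable {X : Type*} [TopologicalSpace X] (g : X → ℝ) : Prop :=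
  letI : MeasurableSpace X := borel X
  ∀ μ : Measure X, IsProbabilityMeasure μ → μ.InnerRegular → NullMeasurable g μ

/-! ### Computation states structures -/

/-- A computation states structure: a set `L` of states with real-valued features indexed by the
set `P` of predicate symbols, in which a state is determined by its type. -/
structure ComputationStates (L P : Type*) where
  /-- The value of the predicate `p` at the state `v`. -/
  feature : P → L → ℝ
  type_injective : Function.Injective fun (v : L) (p : P) => feature p v

/-- A sizer: a family of positive reals indexed by the predicates. -/
abbrev Sizer (P : Type*) := {r : P → ℝ // ∀ p, 0 < r p}

namespace ComputationStates

variable {L P : Type*} (S : ComputationStates L P)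

/-- The type of a state. -/
def tp (v : L) : P → ℝ := fun p => S.feature p v

/-- The space of state types: the closure of the set of realized types in `ℝ^P`. -/
def typeSpace : Set (P → ℝ) := closure (range S.tp)

/-- The realized type of a state as a point of the type space. -/
def toTypeSpace (v : L) : S.typeSpace := ⟨S.tp v, subset_closure (mem_range_self v)⟩

/-- The shard `L[r]`. -/
def shard (r : Sizer P) : Set L := {v | ∀ p, S.feature p v ∈ Icc (-r.1 p) (r.1 p)}

/-- The type shard `𝓛[r]`: the closure of `L[r]` in `ℝ^P`. -/
def typeShard (r : Sizer P) : Set (P → ℝ) := closure (S.tp '' S.shard r)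

/-- The space of shard-supported types: the union of all type shards. -/
def shardTypes : Set (P → ℝ) := ⋃ r : Sizer P, S.typeShard r

theorem typeShard_subset (r : Sizer P) : S.typeShard r ⊆ S.shardTypes :=
  subset_iUnion S.typeShard r

theorem tp_mem_shardTypes (v : L) : S.tp v ∈ S.shardTypes := by
  refine mem_iUnion.2 ⟨⟨fun p => |S.feature p v| + 1, fun p => by positivity⟩, ?_⟩
  refine subset_closure ⟨v, fun p => ⟨?_, ?_⟩, rfl⟩
  · have h := neg_abs_le (S.feature p v)
    show -(|S.feature p v| + 1) ≤ S.feature p v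
    linarith
  · have h := le_abs_self (S.feature p v)
    show S.feature p v ≤ |S.feature p v| + 1
    linarith

/-- The realized type of a state as a shard-supported type. -/
def toShardTypes (v : L) : S.shardTypes := ⟨S.tp v, S.tp_mem_shardTypes v⟩

/-- The inclusion of a type shard in the space of shard-supported types. -/
def shardInclusion (r : Sizer P) : S.typeShard r → S.shardTypes :=
  inclusion (S.typeShard_subset r)

/-- A collection `R` of sizers is exhaustive if its shards cover `L`. -/
def IsExhaustive (R : Set (Sizer P)) : Prop := ⋃ r ∈ R, S.shard r = univ

/-- Every member of `Δ` maps `L[r]` into itself for every `r ∈ R`. -/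
def IsConfined (R : Set (Sizer P)) (Δ : Set (L → L)) : Prop :=
  ∀ γ ∈ Δ, ∀ r ∈ R, MapsTo γ (S.shard r) (S.shard r)

/-- For each sizer `r` there is one sizer `s` such that every member of `Δ` maps `L[r]` into
`L[s]`. -/
def IsUniformlyShardBounded (Δ : Set (L → L)) : Prop :=
  ∀ r : Sizer P, ∃ s : Sizer P, ∀ γ ∈ Δ, MapsTo γ (S.shard r) (S.shard s)

/-- `g` is a `K`-extension of the transition `γ`: it extends `γ`, and for each sizer `r` it
restricts to a continuous map from `𝓛[r]` into `𝓛[s]` for some sizer `s`. -/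
def IsKExtension (γ : L → L) (g : S.shardTypes → S.shardTypes) : Prop :=
  (∀ v, g (S.toShardTypes v) = S.toShardTypes (γ v)) ∧
  ∀ r : Sizer P, ∃ s : Sizer P,
    (∀ x : S.typeShard r, (g (S.shardInclusion r x) : P → ℝ) ∈ S.typeShard s) ∧
    Continuous fun x : S.typeShard r => g (S.shardInclusion r x)

/-- `γ` is extendable if it has a `K`-extension. -/
def IsExtendable (γ : L → L) : Prop := ∃ g, S.IsKExtension γ g

/-- The `p`-th features of the `K`-extensions of the members of `Δ`, as real functions on the
compact space `𝓛[r]`. -/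
def featureFunctions (Δ : Set (L → L)) (p : P) (r : Sizer P) : Set (S.typeShard r → ℝ) :=
  {h | ∃ γ ∈ Δ, ∃ g, S.IsKExtension γ g ∧
    h = fun x => (g (S.shardInclusion r x) : P → ℝ) p}

/-- The deep computations of `Δ`: the closure of `Δ` in the power `𝓛^L` with the product
topology. -/
def deepComputations (Δ : Set (L → L)) : Set (L → S.typeSpace) :=
  closure ((fun γ v => S.toTypeSpace (γ v)) '' Δ)

/-- `f : L → 𝓛` is universally Monte Carlo computable on the shards of the collection `R`: it has
an extension to a self-map of the space of shard-supported types that, for every `r ∈ R`,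
restricts to a universally measurable map from `𝓛[r]` into `𝓛[s]` for some sizer `s`. -/
def IsMonteCarloComputableOn (R : Set (Sizer P)) (f : L → S.typeSpace) : Prop :=
  ∃ g : S.shardTypes → S.shardTypes,
    (∀ v, (g (S.toShardTypes v) : P → ℝ) = (f v : P → ℝ)) ∧
    ∀ r ∈ R, ∃ s : Sizer P,
      (∀ x : S.typeShard r, (g (S.shardInclusion r x) : P → ℝ) ∈ S.typeShard s) ∧
      ∀ p : P, IsUniversallyMeasurable
        fun x : S.typeShard r => (g (S.shardInclusion r x) : P → ℝ) p

/-- Universal Monte Carlo computability: the preceding condition with all sizers. -/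
def IsUniversallyMonteCarloComputable (f : L → S.typeSpace) : Prop :=
  S.IsMonteCarloComputableOn univ f

end ComputationStates

/-- A compositional computation structure: a computation states structure with a set of
transitions (the computations) that is closed under composition and contains the identity. -/
structure CCS (L P : Type*) extends ComputationStates L P where
  /-- The set `Γ` of computations. -/
  computations : Set (L → L)
  id_mem : id ∈ computations
  comp_mem : ∀ γ ∈ computations, ∀ δ ∈ computations, γ ∘ δ ∈ computations

/-- The Extendibility Axiom: every computation is extendable. -/
def CCS.ExtendibilityAxiom {L P : Type*} (C : CCS L P) : Prop :=
  ∀ γ ∈ C.computations, C.IsExtendable γ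

/-!
A function `f` in a Talagrand `μ`-stable set is `μ`-measurable. Otherwise there are `a < b` and a
set `E` of positive measure in which both `{f ≤ a}` and `{b ≤ f}` have full outer measure. The
product of `2k` sets alternating between the two then has outer measure `μ(E)^{2k}`, for every
`k`, contrary to stability (`IsTalagrandStable.nullMeasurable`). Stability passes to pointwise
closures, because a strict enlargement of the gap `a < b` absorbs the approximation
(`IsTalagrandStable.closure`). Hence pointwise limits of members of a universally stable set are
universally measurable.

A deep computation `f` is the pointwise limit of `γ` along an ultrafilter on `Δ`. If all `γ ∈ Δ`
map `L[r]` into `L[s]`, then, by continuity, their `K`-extensions map `𝓛[r]` into the compact space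
`𝓛[s]`, so they converge pointwise on `𝓛[r]` along that ultrafilter. The limits for the various `r`
agree, since they are limits in a Hausdorff space, and form the required extension of `f`.
-/

open Filter Topology

/-- If a pointwise limit of functions in `A` crosses the gap from `a` to `b` on a finite family of
points, then some function in `A` crosses any strictly smaller gap on the same family. -/
theorem talagrandSet_closure_subset {X : Type*} (A : Set (X → ℝ)) (E : Set X) (k : ℕ)
    {a a' b' b : ℝ} (ha : a < a') (hb : b' < b) :
    talagrandSet (closure A) E k a b ⊆ talagrandSet A E k a' b' := by
  rintro x ⟨hxE, f, hf, hx⟩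
  refine ⟨hxE, ?_⟩
  have hev : ∀ᶠ g in 𝓝 f, ∀ i : Fin k,
      g (x ⟨2 * i.val, by omega⟩) ≤ a' ∧ b' ≤ g (x ⟨2 * i.val + 1, by omega⟩) := by
    refine eventually_all.2 fun i => ?_
    have hlow := (continuous_apply (A := fun _ : X => ℝ) (x ⟨2 * i.val, by omega⟩)).tendsto f
    have hhigh :=
      (continuous_apply (A := fun _ : X => ℝ) (x ⟨2 * i.val + 1, by omega⟩)).tendsto f
    filter_upwards [hlow.eventually_lt_const ((hx i).1.trans_lt ha),
      hhigh.eventually_const_lt (hb.trans_le (hx i).2)] with g h₁ h₂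
    exact ⟨h₁.le, h₂.le⟩
  obtain ⟨g, hg, hgA⟩ := ((mem_closure_iff_frequently.1 hf).and_eventually hev).exists
  exact ⟨g, hg, hgA⟩

theorem IsTalagrandStable.closure {X : Type*} [MeasurableSpace X] {μ : Measure X}
    {A : Set (X → ℝ)} (hA : IsTalagrandStable μ A) : IsTalagrandStable μ (closure A) := by
  intro E hE hE0 a b hab
  obtain ⟨a', haa', ha'b⟩ := exists_between hab
  obtain ⟨b', ha'b', hb'b⟩ := exists_between ha'b
  obtain ⟨k, hk, hlt⟩ := hA E hE hE0 a' b' ha'b'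
  exact ⟨k, hk, (measure_mono (talagrandSet_closure_subset A E k haa' hb'b)).trans_lt hlt⟩

/-- The product of copies of `E ∩ {f ≤ a}` and `E ∩ {b ≤ f}` lies in `talagrandSet A E k a b`, and
its outer measure is the product of the outer measures of the factors. -/
theorem pow_le_measure_talagrandSet {X : Type*} [MeasurableSpace X] (μ : Measure X)
    [SigmaFinite μ] {A : Set (X → ℝ)} {f : X → ℝ} (hf : f ∈ A) (E : Set X) (k : ℕ) {a b : ℝ}
    (hlow : μ (E ∩ {x | f x ≤ a}) = μ E) (hhigh : μ (E ∩ {x | b ≤ f x}) = μ E) :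
    μ E ^ (2 * k) ≤ Measure.pi (fun _ : Fin (2 * k) => μ) (talagrandSet A E k a b) := by
  set s : Fin (2 * k) → Set X := fun j =>
    if j.val % 2 = 0 then E ∩ {x | f x ≤ a} else E ∩ {x | b ≤ f x} with hs
  have hμs : ∀ j, μ (s j) = μ E := by
    intro j
    simp only [hs]
    split_ifs
    · exact hlow
    · exact hhigh
  calc μ E ^ (2 * k) = Measure.pi (fun _ : Fin (2 * k) => μ) (univ.pi s) := by
        simp [Measure.pi_pi, hμs]
    _ ≤ _ := by
        refine measure_mono fun x hx => ⟨fun j => ?_, f, hf, fun i => ⟨?_, ?_⟩⟩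
        · have h := hx j (mem_univ j)
          simp only [hs] at h
          split_ifs at h
          · exact h.1
          · exact h.1
        · have h := hx ⟨2 * i.val, by omega⟩ (mem_univ _)
          simp only [hs] at h
          rw [if_pos (by omega)] at h
          exact h.2
        · have h := hx ⟨2 * i.val + 1, by omega⟩ (mem_univ _)
          simp only [hs] at h
          rw [if_neg (by omega)] at h
          exact h.2

theorem IsTalagrandStable.nullMeasurable {X : Type*} [MeasurableSpace X] {μ : Measure X}
    [IsFiniteMeasure μ] {A : Set (X → ℝ)} (hA : IsTalagrandStable μ A) {f : X → ℝ} (hf : f ∈ A) :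
    NullMeasurable f μ := by
  obtain ⟨D, hDc, hDd⟩ := TopologicalSpace.exists_countable_dense EReal
  -- The measurability criterion needs a complete linear order, hence the detour through `EReal`.
  suffices h : AEMeasurable (fun x => (f x : EReal)) μ from h.ereal_toReal.nullMeasurable
  refine aemeasurable_of_exist_almost_disjoint_supersets μ D hDc hDd _ fun p _ q _ hpq => ?_
  obtain ⟨a, hpa, haq⟩ := EReal.lt_iff_exists_real_btwn.1 hpq
  obtain ⟨b, hab', hbq⟩ := EReal.lt_iff_exists_real_btwn.1 haq
  have hab : a < b := EReal.coe_lt_coe_iff.1 hab'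
  -- Both `{f ≤ a}` and `{b ≤ f}` have full outer measure in the intersection of their hulls.
  set U := toMeasurable μ {x | f x ≤ a}
  set V := toMeasurable μ {x | b ≤ f x}
  have hU : MeasurableSet U := measurableSet_toMeasurable _ _
  have hV : MeasurableSet V := measurableSet_toMeasurable _ _
  have hUsub : {x | f x ≤ a} ⊆ U := subset_toMeasurable _ _
  have hVsub : {x | b ≤ f x} ⊆ V := subset_toMeasurable _ _
  refine ⟨U, V, hU, hV, fun x hx => hUsub (EReal.coe_le_coe_iff.1 (hx.trans hpa).le),
    fun x hx => hVsub (EReal.coe_le_coe_iff.1 (hbq.trans hx).le), ?_⟩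
  by_contra hne
  obtain ⟨k, -, hlt⟩ := hA (U ∩ V) (hU.inter hV).nullMeasurableSet (pos_iff_ne_zero.2 hne) a b hab
  refine hlt.not_ge (pow_le_measure_talagrandSet μ hf _ k ?_ ?_)
  · rw [Measure.measure_toMeasurable_inter_of_sFinite hV]
    congr 1
    ext x
    exact ⟨fun h => ⟨h.2, h.1.2⟩, fun h => ⟨⟨hUsub h.1, h.2⟩, h.1⟩⟩
  · rw [inter_comm U V, Measure.measure_toMeasurable_inter_of_sFinite hU]
    congr 1
    ext x
    exact ⟨fun h => ⟨h.2, h.1.2⟩, fun h => ⟨⟨hVsub h.1, h.2⟩, h.1⟩⟩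

theorem IsUniversallyTalagrandStable.isUniversallyMeasurable_of_mem_closure {X : Type*}
    [TopologicalSpace X] {A : Set (X → ℝ)} (hA : IsUniversallyTalagrandStable A) {f : X → ℝ}
    (hf : f ∈ closure A) : IsUniversallyMeasurable f := by
  let _ : MeasurableSpace X := borel X
  intro μ hμ hμr
  exact (hA μ hμ hμr).closure.nullMeasurable hf

namespace ComputationStates

variable {L P : Type*} (S : ComputationStates L P)

theorem isCompact_typeShard (r : Sizer P) : IsCompact (S.typeShard r) := by
  refine (isCompact_univ_pi fun p => isCompact_Icc (a := -r.1 p) (b := r.1 p)).closure_of_subset ?_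
  rintro _ ⟨v, hv, rfl⟩ p -
  exact hv p

theorem isExhaustive_univ : S.IsExhaustive univ := by
  refine eq_univ_of_forall fun v => mem_iUnion₂.2
    ⟨⟨fun p => |S.feature p v| + 1, fun p => by positivity⟩, mem_univ _, fun p => ?_⟩
  exact abs_le.1 (le_add_of_nonneg_right zero_le_one)

variable {S}

theorem IsKExtension.mem_typeShard {γ : L → L} {g : S.shardTypes → S.shardTypes}
    (hg : S.IsKExtension γ g) {r s : Sizer P} (hγ : MapsTo γ (S.shard r) (S.shard s))
    (x : S.typeShard r) : (g (S.shardInclusion r x) : P → ℝ) ∈ S.typeShard s := by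
  obtain ⟨-, -, hcont⟩ := hg.2 r
  have hclosed : IsClosed {y : S.typeShard r |
      (g (S.shardInclusion r y) : P → ℝ) ∈ S.typeShard s} :=
    isClosed_closure.preimage (continuous_subtype_val.comp hcont)
  have hx : x ∈ closure {y : S.typeShard r | (y : P → ℝ) ∈ S.tp '' S.shard r} := by
    rw [closure_subtype]
    refine closure_mono ?_ x.2
    exact fun y hy => ⟨⟨y, subset_closure hy⟩, hy, rfl⟩
  refine closure_minimal ?_ hclosed hx
  rintro ⟨_, hy⟩ ⟨v, hv, rfl⟩
  have hgv : g (S.shardInclusion r ⟨S.tp v, hy⟩) = S.toShardTypes (γ v) := hg.1 v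
  change ((g (S.shardInclusion r ⟨S.tp v, hy⟩) : S.shardTypes) : P → ℝ) ∈ S.typeShard s
  rw [hgv]
  exact subset_closure ⟨γ v, hγ hv, rfl⟩

theorem exists_ultrafilter_of_mem_deepComputations {Δ : Set (L → L)} {f : L → S.typeSpace}
    (hf : f ∈ S.deepComputations Δ) :
    ∃ u : Ultrafilter Δ, ∀ v, Tendsto (fun γ : Δ => S.tp (γ.1 v)) u (𝓝 (f v : P → ℝ)) := by
  rw [deepComputations, image_eq_range] at hf
  have hne : (comap (fun (γ : Δ) v => S.toTypeSpace (γ.1 v)) (𝓝 f)).NeBot := by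
    refine comap_neBot fun t ht => ?_
    obtain ⟨_, hy, γ, rfl⟩ := mem_closure_iff_nhds.1 hf t ht
    exact ⟨γ, hy⟩
  refine ⟨Ultrafilter.of (comap (fun (γ : Δ) v => S.toTypeSpace (γ.1 v)) (𝓝 f)), fun v => ?_⟩
  have hlim : Tendsto (fun (γ : Δ) v => S.toTypeSpace (γ.1 v)) (Ultrafilter.of
      (comap (fun (γ : Δ) v => S.toTypeSpace (γ.1 v)) (𝓝 f))) (𝓝 f) :=
    tendsto_comap.mono_left (Ultrafilter.of_le _)
  exact (continuous_subtype_val.tendsto _).comp (tendsto_pi_nhds.1 hlim v)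

/-- A uniform bound on the images of the shards of `R` is all that is used of confinement: it
keeps the `K`-extensions of the members of `Δ` inside one compact set on each `𝓛[r]`. -/
theorem isMonteCarloComputableOn_of_bounded {R : Set (Sizer P)} (hR : S.IsExhaustive R)
    {Δ : Set (L → L)} (hExt : ∀ γ ∈ Δ, S.IsExtendable γ)
    (hbdd : ∀ r ∈ R, ∃ s : Sizer P, ∀ γ ∈ Δ, MapsTo γ (S.shard r) (S.shard s))
    (hstable : ∀ (p : P), ∀ r ∈ R, IsUniversallyTalagrandStable (S.featureFunctions Δ p r))
    {f : L → S.typeSpace} (hf : f ∈ S.deepComputations Δ) :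
    S.IsMonteCarloComputableOn R f := by
  obtain ⟨u, hu⟩ := exists_ultrafilter_of_mem_deepComputations hf
  choose K hK using fun γ : Δ => hExt γ.1 γ.2
  have hlim : ∀ r ∈ R, ∃ s : Sizer P, ∀ x : S.typeShard r, ∃ y ∈ S.typeShard s,
      Tendsto (fun γ : Δ => (K γ (S.shardInclusion r x) : P → ℝ)) u (𝓝 y) := by
    intro r hr
    obtain ⟨s, hs⟩ := hbdd r hr
    refine ⟨s, fun x => (S.isCompact_typeShard s).ultrafilter_le_nhds'
      (u.map fun γ => (K γ (S.shardInclusion r x) : P → ℝ)) ?_⟩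
    refine Eventually.of_forall (f := (u : Filter Δ)) fun γ => (hK γ).mem_typeShard (hs γ.1 γ.2) x
  -- Off the shards of `R` the limit need not exist, and the extension may take any value.
  have hex : ∀ x : S.shardTypes, ∃ y : S.shardTypes, (∃ r ∈ R, (x : P → ℝ) ∈ S.typeShard r) →
      Tendsto (fun γ : Δ => (K γ x : P → ℝ)) u (𝓝 (y : P → ℝ)) := by
    intro x
    by_cases hx : ∃ r ∈ R, (x : P → ℝ) ∈ S.typeShard r
    · obtain ⟨r, hr, hxr⟩ := hx
      obtain ⟨s, hs⟩ := hlim r hr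
      obtain ⟨y, hy, hxy⟩ := hs ⟨x, hxr⟩
      exact ⟨⟨y, S.typeShard_subset s hy⟩, fun _ => hxy⟩
    · exact ⟨x, fun h => absurd h hx⟩
  choose g hg using hex
  refine ⟨g, fun v => ?_, fun r hr => ?_⟩
  · obtain ⟨r, hr, hv⟩ := mem_iUnion₂.1 (hR.symm ▸ mem_univ v : v ∈ ⋃ r ∈ R, S.shard r)
    have hgv := hg (S.toShardTypes v) ⟨r, hr, subset_closure ⟨v, hv, rfl⟩⟩
    refine tendsto_nhds_unique hgv ((hu v).congr fun γ => ?_)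
    rw [(hK γ).1 v]
    rfl
  · have hgr := fun x : S.typeShard r => hg (S.shardInclusion r x) ⟨r, hr, x.2⟩
    obtain ⟨s, hs⟩ := hlim r hr
    refine ⟨s, fun x => ?_, fun p => ?_⟩
    · obtain ⟨y, hy, hxy⟩ := hs x
      exact tendsto_nhds_unique (hgr x) hxy ▸ hy
    · refine (hstable p r hr).isUniversallyMeasurable_of_mem_closure ?_
      refine mem_closure_of_tendsto (b := (u : Filter Δ))
        (f := fun γ x => (K γ (S.shardInclusion r x) : P → ℝ) p)
        (tendsto_pi_nhds.2 fun x => tendsto_pi_nhds.1 (hgr x) p) ?_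
      exact Eventually.of_forall fun γ => ⟨γ.1, γ.2, K γ, hK γ, rfl⟩

end ComputationStates

theorem mainTheorem3 {L P : Type*} (C : CCS L P) (hExt : C.ExtendibilityAxiom)
    (R : Set (Sizer P)) (hR : C.IsExhaustive R)
    (Δ : Set (L → L)) (hΔ : Δ ⊆ C.computations) (hconf : C.IsConfined R Δ)
    (hstable : ∀ (p : P) (r : Sizer P),
      IsUniversallyTalagrandStable (C.featureFunctions Δ p r)) :
    ∀ f ∈ C.deepComputations Δ,
      C.IsMonteCarloComputableOn R f ∧
      (C.IsUniformlyShardBounded Δ → C.IsUniversallyMonteCarloComputable f) := by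
  intro f hf
  have hExtΔ : ∀ γ ∈ Δ, C.IsExtendable γ := fun γ hγ => hExt γ (hΔ hγ)
  refine ⟨?_, fun hbdd => ?_⟩
  · exact ComputationStates.isMonteCarloComputableOn_of_bounded hR hExtΔ
      (fun r hr => ⟨r, fun γ hγ => hconf γ hγ r hr⟩) (fun p r _ => hstable p r) hf
  · exact ComputationStates.isMonteCarloComputableOn_of_bounded C.isExhaustive_univ hExtΔ
      (fun r _ => hbdd r) (fun p r _ => hstable p r) hf
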